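/- Let $A_0,\dots,A_m\in\mathbb{R}^{n\times n}$, $a_0,\dots,a_m\in\mathbb{R}^n$, let $\Omega\subset\mathbb{R}^m$ be a convex and compact neighborhood of $0$, and let $\mathcal{U}=\{u\in L^\infty(\mathbb{R},\mathbb{R}^m) : u(t)\in\Omega\text{ for almost all }t\}$. Consider the affine control system on $\mathbb{R}^n$ (with the metric of the maximum norm) $$\dot x(t)=A_0x(t)+a_0+\sum_{i=1}^m u_i(t)\,[A_ix(t)+a_i],\qquad u\in\mathcal{U}, \qquad (1)$$ and, with $A_i'=\begin{pmatrix}A_i&a_i\\0&0\end{pmatrix}$, the induced control system $$\dot s=[A_0'-s^{T}A_0's\cdot I]\,s+\sum_{i=1}^m u_i(t)\,[A_i'-s^{T}A_i's\cdot I]\,s,\qquad u\in\mathcal{U}, \qquad (2)$$ on the open northern hemisphere $\mathbb{S}^{n,+}=\{s\in\mathbb{R}^{n+1}:\sum_{i=1}^{n+1}s_i^2=1,\ s_{n+1}>0\}$ of the Poincaré sphere, with the metric $d(s,s')=\max_i|s_i-s_i'|$. Solutions are understood in the sense of Carathéodory, on all of $\mathbb{R}$. For a control system on a metric space $(M,d)$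 with trajectories $\varphi(t,x,u)$, $t\in\mathbb{R}$, a point $x\in M$ is called strongly chain controllable to $y\in M$ if for every continuous function $\varepsilon:M\to(0,\infty)$ and every $T>0$ there are $k\ge 1$, points $x_0=x,x_1,\dots,x_k=y$ in $M$, controls $u_0,\dots,u_{k-1}\in\mathcal{U}$ and times $T_0,\dots,T_{k-1}\ge T$ with $$d(\varphi(T_j,x_j,u_j),x_{j+1})<\varepsilon(\varphi(T_j,x_j,u_j)),\qquad j=0,\dots,k-1.$$ A nonvoid set $E^*\subset M$ is a strong chain control set if (i) every $x\in E^*$ is strongly chain controllable to every $y\in E^*$, (ii) for every $x\in E^*$ there is $u\in\mathcal{U}$ with $\varphi(t,x,u)\in E^*$ for all $t\in\mathbb{R}$, and (iii) $E^*$ is maximal (with respect to inclusion) with these properties. Let $h:\mathbb{R}^n\to\mathbb{S}^{n,+}$, $h(x)=(x,1)/\|(x,1)\|$, with the Euclidean norm. Then the strong chain control sets of (2) on $\mathbb{S}^{n,+}$ are exactly the sets $h(E^*)$, where $E^*$ runs through the strong chain control sets of (1) on $\mathbb{R}^n$. -/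

import Mathlib

open MeasureTheory

noncomputable section

/-- The set of admissible controls: all `u ∈ L^∞(ℝ, ℝ^m)` with `u(t) ∈ Ω` for almost all `t`. -/
def Controls {m : ℕ} (Ω : Set (Fin m → ℝ)) : Set (Lp (Fin m → ℝ) ⊤ (volume : Measure ℝ)) :=
  {u | ∀ᵐ t : ℝ, u t ∈ Ω}

/-- `γ : ℝ → ℝ^N` is a (global) Carathéodory solution of
`γ'(t) = X₀(γ(t)) + ∑ i, u_i(t) X_i(γ(t))`: it is locally absolutely continuous and
satisfies the equation for almost all `t`. -/
def IsSolution {m N : ℕ} (X₀ : (Fin N → ℝ) → (Fin N → ℝ))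
    (X : Fin m → (Fin N → ℝ) → (Fin N → ℝ))
    (u : Lp (Fin m → ℝ) ⊤ (volume : Measure ℝ)) (γ : ℝ → Fin N → ℝ) : Prop :=
  (∀ a b : ℝ, AbsolutelyContinuousOnInterval γ a b) ∧
    ∀ᵐ t : ℝ, HasDerivAt γ (X₀ (γ t) + ∑ i, u t i • X i (γ t)) t

section Chains

/-! In this section a control system on a metric space `M` with controls in `U` is given by
its trajectories: `Traj u γ` means that `γ : ℝ → M` is a trajectory for the control `u`, i.e.
`γ t = φ(t, γ 0, u)` for all `t`. -/

variable {M U : Type*} [MetricSpace M]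

/-- There is a controlled `(ε, T)`-chain from `x` to `y`, where `ε` is a jump function. -/
def HasControlledChain (Traj : U → (ℝ → M) → Prop) (ε : M → ℝ) (T : ℝ) (x y : M) : Prop :=
  ∃ (k : ℕ) (τ : ℕ → ℝ) (u : ℕ → U) (p : ℕ → M),
    1 ≤ k ∧ p 0 = x ∧ p k = y ∧
    ∀ j < k, T ≤ τ j ∧
      ∃ γ : ℝ → M, Traj (u j) γ ∧ γ 0 = p j ∧ dist (γ (τ j)) (p (j + 1)) < ε (γ (τ j))

/-- `x` is strongly chain controllable to `y`: for every continuous jump function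
`ε : M → (0, ∞)` and every `T > 0` there is a controlled `(ε, T)`-chain from `x` to `y`. -/
def StronglyChainControllable (Traj : U → (ℝ → M) → Prop) (x y : M) : Prop :=
  ∀ ε : M → ℝ, Continuous ε → (∀ z, 0 < ε z) → ∀ T : ℝ, 0 < T →
    HasControlledChain Traj ε T x y

/-- A strong chain control set: a nonvoid set `E` such that (i) every point of `E` is strongly
chain controllable to every point of `E`, (ii) through every point of `E` there is a full
trajectory, for some control, that stays in `E`, and (iii) `E` is maximal with these properties. -/
def IsStrongChainControlSet (Traj : U → (ℝ → M) → Prop) (E : Set M) : Prop :=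
  Maximal (fun F : Set M => F.Nonempty ∧
    (∀ x ∈ F, ∀ y ∈ F, StronglyChainControllable Traj x y) ∧
    (∀ x ∈ F, ∃ (u : U) (γ : ℝ → M), Traj u γ ∧ γ 0 = x ∧ ∀ t, γ t ∈ F)) E

end Chains

/-- Trajectories of the affine control system
`x' = A₀ x + a₀ + ∑ i, u_i(t) (A_i x + a_i)` on `ℝ^n` with controls in `Controls Ω`. -/
def AffineTraj {n m : ℕ} (Ω : Set (Fin m → ℝ))
    (A₀ : Matrix (Fin n) (Fin n) ℝ) (a₀ : Fin n → ℝ)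
    (A : Fin m → Matrix (Fin n) (Fin n) ℝ) (a : Fin m → Fin n → ℝ)
    (u : Controls Ω) (γ : ℝ → Fin n → ℝ) : Prop :=
  IsSolution (fun x => A₀.mulVec x + a₀) (fun i x => (A i).mulVec x + a i) u.1 γ

/-- The vector `(x, z) ∈ ℝ^(n+1)` for `x ∈ ℝ^n`, `z ∈ ℝ`. -/
def extVec {n : ℕ} (x : Fin n → ℝ) (z : ℝ) : Fin (n + 1) → ℝ :=
  Fin.snoc (α := fun _ => ℝ) x z

/-- The block matrix `A' = [[A, a], [0, 0]]`. -/
def extMatrix {n : ℕ} (A : Matrix (Fin n) (Fin n) ℝ) (a : Fin n → ℝ) :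
    Matrix (Fin (n + 1)) (Fin (n + 1)) ℝ :=
  Matrix.of (Fin.snoc (α := fun _ => Fin (n + 1) → ℝ) (fun i => extVec (A i) (a i)) 0)

/-- The vector field `s ↦ [B - (sᵀ B s) I] s` obtained by projecting `y ↦ B y` to the sphere. -/
def sphereField {N : ℕ} (B : Matrix (Fin N) (Fin N) ℝ) (s : Fin N → ℝ) : Fin N → ℝ :=
  B.mulVec s - (s ⬝ᵥ B.mulVec s) • s

/-- The open northern hemisphere of the Poincaré sphere. As a subtype of `Fin (n+1) → ℝ` it
carries the metric `d(s, s') = max_i |s_i - s'_i|`. -/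
def NorthHemisphere (n : ℕ) : Set (Fin (n + 1) → ℝ) :=
  {s | ∑ i, s i ^ 2 = 1 ∧ 0 < s (Fin.last n)}

/-- Trajectories of the induced control system on the open northern hemisphere. -/
def HemisphereTraj {n m : ℕ} (Ω : Set (Fin m → ℝ))
    (A₀ : Matrix (Fin n) (Fin n) ℝ) (a₀ : Fin n → ℝ)
    (A : Fin m → Matrix (Fin n) (Fin n) ℝ) (a : Fin m → Fin n → ℝ)
    (u : Controls Ω) (γ : ℝ → NorthHemisphere n) : Prop :=
  IsSolution (sphereField (extMatrix A₀ a₀)) (fun i => sphereField (extMatrix (A i) (a i)))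
    u.1 (fun t => (γ t : Fin (n + 1) → ℝ))

/-- The Euclidean norm on `ℝ^N`. -/
def euclNorm {N : ℕ} (v : Fin N → ℝ) : ℝ := Real.sqrt (∑ i, v i ^ 2)

/-- `(x, 1) / ‖(x, 1)‖` lies in the open northern hemisphere. -/
theorem normalized_mem_northHemisphere {n : ℕ} (x : Fin n → ℝ) :
    (euclNorm (extVec x 1))⁻¹ • extVec x 1 ∈ NorthHemisphere n := by
  have hpos : 0 < ∑ i, extVec x 1 i ^ 2 := by
    rw [Fin.sum_univ_castSucc]
    simp only [extVec, Fin.snoc_castSucc, Fin.snoc_last]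
    positivity
  have hs : 0 < euclNorm (extVec x 1) := Real.sqrt_pos.2 hpos
  refine ⟨?_, ?_⟩
  · simp only [Pi.smul_apply, smul_eq_mul, mul_pow, ← Finset.mul_sum]
    rw [inv_pow, euclNorm, Real.sq_sqrt hpos.le]
    exact inv_mul_cancel₀ hpos.ne'
  · simpa [extVec] using hs

/-- The map `h : ℝ^n → S^{n,+}`, `h(x) = (x, 1) / ‖(x, 1)‖`. -/
def hemisphereMap {n : ℕ} (x : Fin n → ℝ) : NorthHemisphere n :=
  ⟨(euclNorm (extVec x 1))⁻¹ • extVec x 1, normalized_mem_northHemisphere x⟩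

end

/-! The map `hemisphereMap` conjugates the two systems: it is a homeomorphism whose inverse is the
central projection, and both directions send trajectories to trajectories with the same control.
Strong chain control sets are invariant under every topological conjugacy. No uniform continuity is
needed, because a jump function may vary from point to point: `Continuous.exists_continuous_modulus`
pulls it back along any continuous map. Maximality transfers because the inverse has the same
property.

The conjugacy itself comes from homogenization: `(x, 1)` solves a linear equation, normalizing it
adds only a radial term to the field, and the central projection removes that term
(`hasDerivAt_hemisphereMap`, `hasDerivAt_centralProj`). -/

open Filter Topology

/-! ### Invariance of strong chain control sets under conjugacy -/

section Conjugacy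

variable {M N U : Type*} [MetricSpace M] [MetricSpace N]

/-- A continuous map is uniformly continuous up to a continuous positive modulus: for every
continuous `ε > 0` on the target there is a continuous `δ > 0` on the source with
`dist x y < δ x → dist (f x) (f y) < ε (f x)`. -/
theorem Continuous.exists_continuous_modulus {f : M → N} (hf : Continuous f) {ε : N → ℝ}
    (hε : Continuous ε) (hpos : ∀ z, 0 < ε z) :
    ∃ δ : M → ℝ, Continuous δ ∧ (∀ x, 0 < δ x) ∧
      ∀ x y, dist x y < δ x → dist (f x) (f y) < ε (f x) := by
  let t : M → Set ℝ := fun x => {δ | 0 < δ ∧ ∀ y, dist x y < δ → dist (f x) (f y) < ε (f x)}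
  have ht : ∀ x, Convex ℝ (t x) := by
    intro x
    refine Set.OrdConnected.convex ⟨fun a ha b hb c hc => ⟨ha.1.trans_le hc.1, fun y hy => ?_⟩⟩
    exact hb.2 y (hy.trans_le hc.2)
  -- Near `x` the constant `r / 2` is admissible: `y` and `z` both lie within `r` of `x`, so their
  -- images differ by less than `ε (f x) / 2 < ε (f y)`. As the sets `t x` are convex, such local
  -- constants glue to a continuous selection.
  have hloc : ∀ x, ∃ c : ℝ, ∀ᶠ y in 𝓝 x, c ∈ t y := by
    intro x
    have h4 : 0 < ε (f x) / 4 := by linarith [hpos (f x)]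
    obtain ⟨r, hr, hfr⟩ := Metric.continuousAt_iff.1 hf.continuousAt (ε (f x) / 4) h4
    have hev : ∀ᶠ y in 𝓝 x, ε (f x) / 2 < ε (f y) :=
      (hε.comp hf).continuousAt.eventually (lt_mem_nhds (half_lt_self (hpos (f x))))
    refine ⟨r / 2, ?_⟩
    filter_upwards [hev, Metric.ball_mem_nhds x (half_pos hr)] with y hy hyr
    refine ⟨half_pos hr, fun z hz => ?_⟩
    rw [Metric.mem_ball] at hyr
    have hzx : dist z x < r := by
      linarith [dist_triangle z y x, dist_comm y z]
    have hfz := hfr hzx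
    have hfy := hfr (hyr.trans (half_lt_self hr))
    linarith [dist_triangle_right (f y) (f z) (f x)]
  obtain ⟨g, hg⟩ := exists_continuous_forall_mem_convex_of_local_const ht hloc
  exact ⟨g, g.continuous, fun x => (hg x).1, fun x => (hg x).2⟩

/-- Strong chain controllability is transported by continuous maps that send trajectories to
trajectories. -/
theorem StronglyChainControllable.map {Traj : U → (ℝ → M) → Prop} {Traj' : U → (ℝ → N) → Prop}
    {f : M → N} (hf : Continuous f) (hTraj : ∀ u γ, Traj u γ → Traj' u (f ∘ γ)) {x y : M}
    (h : StronglyChainControllable Traj x y) : StronglyChainControllable Traj' (f x) (f y) := by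
  intro ε hε hpos T hT
  obtain ⟨δ, hδ, hδpos, hδε⟩ := hf.exists_continuous_modulus hε hpos
  obtain ⟨k, τ, u, p, hk, hp0, hpk, hstep⟩ := h δ hδ hδpos T hT
  refine ⟨k, τ, u, f ∘ p, hk, congrArg f hp0, congrArg f hpk, fun j hj => ?_⟩
  obtain ⟨hτ, γ, hγ, hγ0, hd⟩ := hstep j hj
  exact ⟨hτ, f ∘ γ, hTraj _ _ hγ, congrArg f hγ0, hδε _ _ hd⟩

/-- The properties (i) and (ii) in the definition of strong chain control sets are transported by
continuous maps that send trajectories to trajectories. -/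
theorem stronglyChainTransitive_image {Traj : U → (ℝ → M) → Prop} {Traj' : U → (ℝ → N) → Prop}
    {f : M → N} (hf : Continuous f) (hTraj : ∀ u γ, Traj u γ → Traj' u (f ∘ γ)) {E : Set M}
    (h : E.Nonempty ∧ (∀ x ∈ E, ∀ y ∈ E, StronglyChainControllable Traj x y) ∧
      (∀ x ∈ E, ∃ (u : U) (γ : ℝ → M), Traj u γ ∧ γ 0 = x ∧ ∀ t, γ t ∈ E)) :
    (f '' E).Nonempty ∧ (∀ x ∈ f '' E, ∀ y ∈ f '' E, StronglyChainControllable Traj' x y) ∧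
      (∀ x ∈ f '' E, ∃ (u : U) (γ : ℝ → N), Traj' u γ ∧ γ 0 = x ∧ ∀ t, γ t ∈ f '' E) := by
  obtain ⟨hne, hchain, hinv⟩ := h
  refine ⟨hne.image f, ?_, ?_⟩
  · rintro _ ⟨x, hx, rfl⟩ _ ⟨y, hy, rfl⟩
    exact (hchain x hx y hy).map hf hTraj
  · rintro _ ⟨x, hx, rfl⟩
    obtain ⟨u, γ, hγ, hγ0, hγE⟩ := hinv x hx
    exact ⟨u, f ∘ γ, hTraj u γ hγ, congrArg f hγ0, fun t => Set.mem_image_of_mem f (hγE t)⟩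

/-- A topological conjugacy of control systems maps strong chain control sets to strong chain
control sets. -/
theorem IsStrongChainControlSet.image {Traj : U → (ℝ → M) → Prop} {Traj' : U → (ℝ → N) → Prop}
    (e : M ≃ₜ N) (hTraj : ∀ u γ, Traj u γ → Traj' u (e ∘ γ))
    (hTraj' : ∀ u γ, Traj' u γ → Traj u (e.symm ∘ γ)) {E : Set M}
    (h : IsStrongChainControlSet Traj E) : IsStrongChainControlSet Traj' (e '' E) := by
  refine ⟨stronglyChainTransitive_image e.continuous hTraj h.prop, fun F hF hEF => ?_⟩
  have hsub : E ⊆ e.symm '' F := fun x hx =>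
    ⟨e x, hEF (Set.mem_image_of_mem e hx), e.symm_apply_apply x⟩
  -- A larger competitor `F` pulls back to a competitor of `E`, which maximality of `E` absorbs.
  have hmax := h.2 (stronglyChainTransitive_image e.symm.continuous hTraj' hF) hsub
  exact fun y hy => ⟨e.symm y, hmax ⟨y, hy, rfl⟩, e.apply_symm_apply y⟩

/-- Under a topological conjugacy of control systems the strong chain control sets are exactly the
images of the strong chain control sets. -/
theorem isStrongChainControlSet_iff_exists_image {Traj : U → (ℝ → M) → Prop}
    {Traj' : U → (ℝ → N) → Prop} (e : M ≃ₜ N) (hTraj : ∀ u γ, Traj u γ → Traj' u (e ∘ γ))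
    (hTraj' : ∀ u γ, Traj' u γ → Traj u (e.symm ∘ γ)) (F : Set N) :
    IsStrongChainControlSet Traj' F ↔ ∃ E, IsStrongChainControlSet Traj E ∧ F = e '' E := by
  constructor
  · intro hF
    exact ⟨e.symm '' F, hF.image e.symm hTraj' hTraj, by rw [e.image_symm, e.image_preimage]⟩
  · rintro ⟨E, hE, rfl⟩
    exact hE.image e hTraj hTraj'

end Conjugacy

/-- Absolute continuity is preserved by composition with locally Lipschitz maps. -/
theorem AbsolutelyContinuousOnInterval.comp_locallyLipschitzOn {E X : Type*}
    [SeminormedAddCommGroup E] [PseudoMetricSpace X] {f : ℝ → E} {g : E → X} {s : Set E}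
    {a b : ℝ} (hf : AbsolutelyContinuousOnInterval f a b) (hg : LocallyLipschitzOn s g)
    (hs : ∀ t, f t ∈ s) : AbsolutelyContinuousOnInterval (g ∘ f) a b := by
  -- The image of the interval is compact, so one Lipschitz constant serves on all of it.
  obtain ⟨K, hK⟩ := (hg.mono (Set.image_subset_iff.2 fun t _ => hs t :
    f '' Set.uIcc a b ⊆ s)).exists_lipschitzOnWith_of_compact
      (isCompact_uIcc.image_of_continuousOn hf.continuousOn)
  have hlim := Tendsto.const_mul (K : ℝ) hf
  rw [mul_zero] at hlim
  refine squeeze_zero' (Eventually.of_forall fun _ => Finset.sum_nonneg fun _ _ => dist_nonneg)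
    ?_ hlim
  rw [eventually_inf_principal]
  filter_upwards with I hI
  rw [Finset.mul_sum]
  refine Finset.sum_le_sum fun i hi => ?_
  exact hK.dist_le_mul _ (Set.mem_image_of_mem f (hI.1 i hi).1) _
    (Set.mem_image_of_mem f (hI.1 i hi).2)

/-! ### Linearity of the vector fields in the matrix data -/

section Fields

variable {n m N : ℕ}

/-- The field is linear in the matrix, so at a fixed time the control value `w` can be absorbed and
only a single matrix has to be treated. -/
theorem sphereField_add_sum_smul (B₀ : Matrix (Fin N) (Fin N) ℝ)
    (B : Fin m → Matrix (Fin N) (Fin N) ℝ) (w : Fin m → ℝ) (s : Fin N → ℝ) :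
    sphereField B₀ s + ∑ i, w i • sphereField (B i) s = sphereField (B₀ + ∑ i, w i • B i) s := by
  simp only [sphereField, Matrix.add_mulVec, Matrix.sum_mulVec, Matrix.smul_mulVec,
    dotProduct_add, dotProduct_sum, dotProduct_smul, smul_sub, Finset.sum_sub_distrib, add_smul,
    Finset.sum_smul, smul_assoc]
  abel

theorem affineField_add_sum_smul (A₀ : Matrix (Fin n) (Fin n) ℝ) (a₀ : Fin n → ℝ)
    (A : Fin m → Matrix (Fin n) (Fin n) ℝ) (a : Fin m → Fin n → ℝ) (w : Fin m → ℝ)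
    (x : Fin n → ℝ) :
    (A₀.mulVec x + a₀) + ∑ i, w i • ((A i).mulVec x + a i) =
      (A₀ + ∑ i, w i • A i).mulVec x + (a₀ + ∑ i, w i • a i) := by
  simp only [Matrix.add_mulVec, Matrix.sum_mulVec, Matrix.smul_mulVec, smul_add,
    Finset.sum_add_distrib]
  abel

theorem extMatrix_castSucc_castSucc (A : Matrix (Fin n) (Fin n) ℝ) (a : Fin n → ℝ)
    (i j : Fin n) : extMatrix A a i.castSucc j.castSucc = A i j := by
  simp [extMatrix, extVec]

theorem extMatrix_castSucc_last (A : Matrix (Fin n) (Fin n) ℝ) (a : Fin n → ℝ) (i : Fin n) :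
    extMatrix A a i.castSucc (Fin.last n) = a i := by
  simp [extMatrix, extVec]

theorem extMatrix_last (A : Matrix (Fin n) (Fin n) ℝ) (a : Fin n → ℝ) (j : Fin (n + 1)) :
    extMatrix A a (Fin.last n) j = 0 := by
  simp [extMatrix]

theorem extMatrix_add_sum_smul (A₀ : Matrix (Fin n) (Fin n) ℝ) (a₀ : Fin n → ℝ)
    (A : Fin m → Matrix (Fin n) (Fin n) ℝ) (a : Fin m → Fin n → ℝ) (w : Fin m → ℝ) :
    extMatrix A₀ a₀ + ∑ i, w i • extMatrix (A i) (a i) =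
      extMatrix (A₀ + ∑ i, w i • A i) (a₀ + ∑ i, w i • a i) := by
  ext i j
  refine Fin.lastCases ?_ (fun i => ?_) i
  · simp [Matrix.sum_apply, extMatrix_last]
  · refine Fin.lastCases ?_ (fun j => ?_) j
    · simp [Matrix.sum_apply, extMatrix_castSucc_last]
    · simp [Matrix.sum_apply, extMatrix_castSucc_castSucc]

theorem extMatrix_mulVec_castSucc (A : Matrix (Fin n) (Fin n) ℝ) (a : Fin n → ℝ)
    (v : Fin (n + 1) → ℝ) (i : Fin n) :
    (extMatrix A a).mulVec v i.castSucc =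
      A.mulVec (fun j => v j.castSucc) i + a i * v (Fin.last n) := by
  simp [Matrix.mulVec, dotProduct, Fin.sum_univ_castSucc, extMatrix_castSucc_castSucc,
    extMatrix_castSucc_last]

theorem extMatrix_mulVec_last (A : Matrix (Fin n) (Fin n) ℝ) (a : Fin n → ℝ)
    (v : Fin (n + 1) → ℝ) : (extMatrix A a).mulVec v (Fin.last n) = 0 := by
  simp [Matrix.mulVec, dotProduct, extMatrix_last]

end Fields

/-! ### The conjugacy between affine space and the hemisphere -/

section Hemisphere

variable {n m N : ℕ}

theorem sum_sq_extVec_one_pos (x : Fin n → ℝ) : 0 < ∑ i, extVec x 1 i ^ 2 := by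
  rw [Fin.sum_univ_castSucc]
  simp only [extVec, Fin.snoc_castSucc, Fin.snoc_last]
  positivity

theorem contDiff_hemisphereMap :
    ContDiff ℝ 1 (fun x : Fin n → ℝ => (hemisphereMap x : Fin (n + 1) → ℝ)) := by
  have hext : ContDiff ℝ 1 (fun x : Fin n → ℝ => extVec x 1) := by
    rw [contDiff_pi]
    intro i
    refine Fin.lastCases ?_ (fun i => ?_) i
    · simpa [extVec] using contDiff_const
    · simpa [extVec] using contDiff_apply ℝ ℝ i
  have hsum : ContDiff ℝ 1 (fun x : Fin n → ℝ => ∑ i, extVec x 1 i ^ 2) :=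
    ContDiff.sum fun i _ => (contDiff_pi.1 hext i).pow 2
  have hnorm : ContDiff ℝ 1 (fun x : Fin n → ℝ => euclNorm (extVec x 1)) :=
    hsum.sqrt fun x => (sum_sq_extVec_one_pos x).ne'
  exact (hnorm.inv fun x => (Real.sqrt_pos.2 (sum_sq_extVec_one_pos x)).ne').smul hext

/-- The central projection `s ↦ (s_1, …, s_n) / s_{n+1}`. -/
noncomputable def centralProj (s : Fin (n + 1) → ℝ) : Fin n → ℝ := fun i => s i.castSucc / s (Fin.last n)

theorem contDiffOn_centralProj :
    ContDiffOn ℝ 1 (centralProj (n := n)) {s | 0 < s (Fin.last n)} := by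
  rw [contDiffOn_pi]
  intro i
  exact (contDiff_apply ℝ ℝ i.castSucc).contDiffOn.div
    (contDiff_apply ℝ ℝ (Fin.last n)).contDiffOn fun s hs => ne_of_gt hs

theorem centralProj_hemisphereMap (x : Fin n → ℝ) :
    centralProj (hemisphereMap x : Fin (n + 1) → ℝ) = x := by
  have h : euclNorm (extVec x 1) ≠ 0 := (Real.sqrt_pos.2 (sum_sq_extVec_one_pos x)).ne'
  ext i
  simp only [centralProj, hemisphereMap, extVec, Pi.smul_apply, Fin.snoc_castSucc, Fin.snoc_last,
    smul_eq_mul] at h ⊢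
  field_simp

theorem hemisphereMap_centralProj (s : NorthHemisphere n) :
    hemisphereMap (centralProj (s : Fin (n + 1) → ℝ)) = s := by
  obtain ⟨s, hs, hpos⟩ := s
  have hext : extVec (centralProj s) 1 = (s (Fin.last n))⁻¹ • s := by
    ext i
    refine Fin.lastCases ?_ (fun i => ?_) i
    · simp [extVec, hpos.ne']
    · simp [extVec, centralProj, div_eq_inv_mul]
  have hnorm : euclNorm (extVec (centralProj s) 1) = (s (Fin.last n))⁻¹ := by
    rw [hext, euclNorm]
    simp only [Pi.smul_apply, smul_eq_mul, mul_pow, ← Finset.mul_sum, hs, mul_one]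
    exact Real.sqrt_sq (inv_pos.2 hpos).le
  apply Subtype.ext
  change (euclNorm (extVec (centralProj s) 1))⁻¹ • extVec (centralProj s) 1 = s
  rw [hnorm, hext, inv_inv, smul_inv_smul₀ hpos.ne']

/-- The map `hemisphereMap` as a homeomorphism; its inverse is the central projection. -/
noncomputable def hemisphereHomeomorph (n : ℕ) : (Fin n → ℝ) ≃ₜ NorthHemisphere n where
  toFun := hemisphereMap
  invFun s := centralProj (s : Fin (n + 1) → ℝ)
  left_inv := centralProj_hemisphereMap
  right_inv := hemisphereMap_centralProj
  continuous_toFun := contDiff_hemisphereMap.continuous.subtype_mk _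
  continuous_invFun :=
    contDiffOn_centralProj.continuousOn.comp_continuous continuous_subtype_val fun s => s.2.2

/-- If `y' = B y` with `y ≠ 0` then `s = y / ‖y‖` satisfies `s' = [B - (sᵀ B s) I] s`. -/
theorem hasDerivAt_normalize {B : Matrix (Fin N) (Fin N) ℝ} {y : ℝ → Fin N → ℝ} {t : ℝ}
    (hy : HasDerivAt y (B.mulVec (y t)) t) (hpos : 0 < ∑ i, y t i ^ 2) :
    HasDerivAt (fun τ => (euclNorm (y τ))⁻¹ • y τ)
      (sphereField B ((euclNorm (y t))⁻¹ • y t)) t := by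
  have hr : euclNorm (y t) ≠ 0 := (Real.sqrt_pos.2 hpos).ne'
  have hsum : HasDerivAt (fun τ => ∑ i, y τ i ^ 2) (2 * (y t ⬝ᵥ B.mulVec (y t))) t := by
    have h := HasDerivAt.fun_sum (u := Finset.univ) fun i _ => (hasDerivAt_pi.1 hy i).fun_pow 2
    refine h.congr_deriv ?_
    rw [dotProduct, Finset.mul_sum]
    refine Finset.sum_congr rfl fun i _ => ?_
    norm_num
    ring
  have hnorm : HasDerivAt (fun τ => euclNorm (y τ))
      (2 * (y t ⬝ᵥ B.mulVec (y t)) / (2 * euclNorm (y t))) t := hsum.sqrt hpos.ne'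
  -- With `r = ‖y‖` and `r' = yᵀBy / r`, the product rule gives `By / r - (yᵀBy / r³) y`.
  refine ((hnorm.inv hr).smul hy).congr_deriv ?_
  ext i
  simp only [sphereField, Matrix.mulVec_smul, smul_dotProduct, dotProduct_smul, Pi.add_apply,
    Pi.sub_apply, Pi.smul_apply, Pi.inv_apply, smul_eq_mul]
  field_simp
  ring

/-- The zero last row keeps the last coordinate equal to `1`, so `(γ, 1)` solves the linear equation
and can be normalized. -/
theorem hasDerivAt_hemisphereMap {C : Matrix (Fin n) (Fin n) ℝ} {c : Fin n → ℝ}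
    {γ : ℝ → Fin n → ℝ} {t : ℝ} (hγ : HasDerivAt γ (C.mulVec (γ t) + c) t) :
    HasDerivAt (fun τ => (hemisphereMap (γ τ) : Fin (n + 1) → ℝ))
      (sphereField (extMatrix C c) (hemisphereMap (γ t))) t := by
  refine hasDerivAt_normalize (y := fun τ => extVec (γ τ) 1) ?_ (sum_sq_extVec_one_pos (γ t))
  rw [hasDerivAt_pi]
  intro i
  refine Fin.lastCases ?_ (fun i => ?_) i
  · rw [extMatrix_mulVec_last]
    simpa [extVec] using hasDerivAt_const t (1 : ℝ)
  · rw [extMatrix_mulVec_castSucc]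
    simpa [extVec] using hasDerivAt_pi.1 hγ i

/-- Ratios of coordinates do not see the radial term `(sᵀBs) s`, and the zero last row makes it the
only contribution of the denominator. -/
theorem hasDerivAt_centralProj {C : Matrix (Fin n) (Fin n) ℝ} {c : Fin n → ℝ}
    {σ : ℝ → Fin (n + 1) → ℝ} {t : ℝ} (hσ : HasDerivAt σ (sphereField (extMatrix C c) (σ t)) t)
    (hpos : 0 < σ t (Fin.last n)) :
    HasDerivAt (fun τ => centralProj (σ τ)) (C.mulVec (centralProj (σ t)) + c) t := by
  rw [hasDerivAt_pi] at hσ ⊢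
  intro i
  refine ((hσ i.castSucc).fun_div (hσ (Fin.last n)) hpos.ne').congr_deriv ?_
  have hproj : centralProj (σ t) = (σ t (Fin.last n))⁻¹ • fun j : Fin n => σ t j.castSucc := by
    ext j
    simp [centralProj, div_eq_inv_mul]
  rw [hproj, Matrix.mulVec_smul]
  simp only [sphereField, Pi.add_apply, Pi.sub_apply, Pi.smul_apply, smul_eq_mul,
    extMatrix_mulVec_castSucc, extMatrix_mulVec_last]
  have := hpos.ne'
  field_simp
  ring

variable {Ω : Set (Fin m → ℝ)} {A₀ : Matrix (Fin n) (Fin n) ℝ} {a₀ : Fin n → ℝ}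
  {A : Fin m → Matrix (Fin n) (Fin n) ℝ} {a : Fin m → Fin n → ℝ} {u : Controls Ω}

theorem AffineTraj.hemisphereTraj {γ : ℝ → Fin n → ℝ} (h : AffineTraj Ω A₀ a₀ A a u γ) :
    HemisphereTraj Ω A₀ a₀ A a u (hemisphereMap ∘ γ) := by
  refine ⟨fun b c => ?_, ?_⟩
  · have hac : AbsolutelyContinuousOnInterval γ b c := h.1 b c
    have hlip : LocallyLipschitzOn Set.univ
        (fun x : Fin n → ℝ => (hemisphereMap x : Fin (n + 1) → ℝ)) :=
      contDiff_hemisphereMap.locallyLipschitz.locallyLipschitzOn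
    have hcomp := hac.comp_locallyLipschitzOn hlip fun t => Set.mem_univ _
    exact hcomp
  · filter_upwards [h.2] with t ht
    rw [affineField_add_sum_smul] at ht
    rw [sphereField_add_sum_smul, extMatrix_add_sum_smul]
    exact hasDerivAt_hemisphereMap ht

theorem HemisphereTraj.affineTraj {σ : ℝ → NorthHemisphere n}
    (h : HemisphereTraj Ω A₀ a₀ A a u σ) :
    AffineTraj Ω A₀ a₀ A a u (fun t => centralProj (σ t : Fin (n + 1) → ℝ)) := by
  -- Passing from `C¹` to locally Lipschitz uses a convex domain, hence the half-space in place of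
  -- the hemisphere.
  have hconv : Convex ℝ {s : Fin (n + 1) → ℝ | 0 < s (Fin.last n)} :=
    convex_halfSpace_gt (LinearMap.proj (R := ℝ) (φ := fun _ => ℝ) (Fin.last n)).isLinear 0
  refine ⟨fun b c => ?_, ?_⟩
  · have hac : AbsolutelyContinuousOnInterval (fun t => (σ t : Fin (n + 1) → ℝ)) b c := h.1 b c
    exact hac.comp_locallyLipschitzOn (g := centralProj)
      (contDiffOn_centralProj.locallyLipschitzOn hconv) fun t => (σ t).2.2
  · filter_upwards [h.2] with t ht
    rw [sphereField_add_sum_smul, extMatrix_add_sum_smul] at ht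
    rw [affineField_add_sum_smul]
    exact hasDerivAt_centralProj ht (σ t).2.2

end Hemisphere

theorem mainTheorem1 {n m : ℕ} (Ω : Set (Fin m → ℝ)) (hΩ_conv : Convex ℝ Ω)
    (hΩ_comp : IsCompact Ω) (hΩ_nhds : Ω ∈ nhds (0 : Fin m → ℝ))
    (A₀ : Matrix (Fin n) (Fin n) ℝ) (a₀ : Fin n → ℝ)
    (A : Fin m → Matrix (Fin n) (Fin n) ℝ) (a : Fin m → Fin n → ℝ)
    (F : Set (NorthHemisphere n)) :
    IsStrongChainControlSet (HemisphereTraj Ω A₀ a₀ A a) F ↔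
      ∃ E : Set (Fin n → ℝ),
        IsStrongChainControlSet (AffineTraj Ω A₀ a₀ A a) E ∧ F = hemisphereMap '' E :=
  isStrongChainControlSet_iff_exists_image (hemisphereHomeomorph n)
    (fun _ _ h => AffineTraj.hemisphereTraj h) (fun _ _ h => HemisphereTraj.affineTraj h) F
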